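/- Let $V:\mathbb R^d\to\mathbb R$ satisfy $V\ge 0$, $V\in L^\infty_{\rm loc}(\mathbb R^d)$ and $\lim_{R\to\infty}\operatorname{ess\,inf}_{|x|\ge R}V(x)=\infty$. Let $H$ be the closure in the complex Hilbert space $L^2(\mathbb R^d)$ of the operator $-\Delta+V$ with domain $C_0^\infty(\mathbb R^d)$; this operator is essentially self-adjoint, so $H$ is its unique self-adjoint extension. Let $\rho(H)$ be the resolvent set of $H$, and write $\langle x\rangle=(1+|x|^2)^{1/2}$. Let $K\subset\rho(H)$ be compact. Then there exist $\omega_K>0$ and $M_K<\infty$ such that for all $z\in K$ and all $0\le\omega\le\omega_K$ the operator $e^{\omega\langle\cdot\rangle}(H-z)^{-1}e^{-\omega\langle\cdot\rangle}$ is defined and bounded on all of $L^2(\mathbb R^d)$, and $$\big\|e^{\omega\langle\cdot\rangle}(H-z)^{-1}e^{-\omega\langle\cdot\rangle}\big\|\le M_K .$$ -/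

import Mathlib

namespace ConfiningSchrodinger

open MeasureTheory Filter Topology
open scoped ENNReal ContDiff InnerProductSpace

noncomputable section

/-! ### Unbounded operators on a complex Hilbert space -/

section UnboundedOperators

variable {X : Type*} [NormedAddCommGroup X] [InnerProductSpace ℂ X]

/-- The composition `B ∘ A` of unbounded operators, on its natural domain
`{u ∈ D(A) | A u ∈ D(B)}`. -/
def pcomp (B A : X →ₗ.[ℂ] X) : X →ₗ.[ℂ] X where
  domain := (B.domain.comap A.toFun).map A.domain.subtype
  toFun :=
    { toFun := fun u => B ⟨A ⟨u, by
          obtain ⟨w, -, hw⟩ := u.2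
          exact hw ▸ w.2⟩, by
          obtain ⟨u, w, hw, rfl⟩ := u
          exact hw⟩
      map_add' := by
        intro u v
        rw [← B.map_add]
        congr 1
        apply Subtype.ext
        exact A.toFun.map_add ⟨(u : X), _⟩ ⟨(v : X), _⟩
      map_smul' := by
        intro c u
        rw [RingHom.id_apply, ← B.map_smul]
        congr 1
        apply Subtype.ext
        exact A.toFun.map_smul c ⟨(u : X), _⟩ }

/-- `R` is the bounded two-sided inverse of `A - z : D(A) → X`. -/
def IsResolventAt (A : X →ₗ.[ℂ] X) (z : ℂ) (R : X →L[ℂ] X) : Prop :=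
  (∀ f : X, ∃ h : R f ∈ A.domain, A ⟨R f, h⟩ - z • R f = f) ∧
    ∀ u : A.domain, R (A u - z • (u : X)) = u

/-- The resolvent set `ρ(A)`: all `z` such that `A - z : D(A) → X` is bijective with a bounded
inverse. -/
def resolventSet (A : X →ₗ.[ℂ] X) : Set ℂ :=
  {z | ∃ R : X →L[ℂ] X, IsResolventAt A z R}

open Classical in
/-- The resolvent `(A - z)⁻¹` for `z ∈ ρ(A)` (and `0` by convention for other `z`). -/
def resolvent (A : X →ₗ.[ℂ] X) (z : ℂ) : X →L[ℂ] X :=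
  if h : ∃ R : X →L[ℂ] X, IsResolventAt A z R then h.choose else 0

/-- A bounded operator, viewed as an unbounded operator with domain the whole space. -/
def ofBounded (T : X →L[ℂ] X) : X →ₗ.[ℂ] X :=
  (T : X →ₗ[ℂ] X).toPMap ⊤

end UnboundedOperators

/-! ### Operators on `L²(ℝᵈ)` -/

/-- Euclidean space `ℝᵈ`. -/
abbrev Space (d : ℕ) : Type := EuclideanSpace ℝ (Fin d)

/-- The complex Hilbert space `L²(ℝᵈ)`. -/
abbrev L2 (d : ℕ) : Type := Lp ℂ 2 (volume : Measure (Space d))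

variable {d : ℕ}

theorem mul_coeFn_add (w : Space d → ℝ) (f g : L2 d) :
    ((fun x => (w x : ℂ) * f x) + fun x => (w x : ℂ) * g x) =ᵐ[volume]
      fun x => (w x : ℂ) * (f + g : L2 d) x := by
  filter_upwards [Lp.coeFn_add f g] with x hx
  rw [hx]
  simp only [Pi.add_apply, mul_add]

theorem mul_coeFn_smul (w : Space d → ℝ) (c : ℂ) (f : L2 d) :
    (c • fun x => (w x : ℂ) * f x) =ᵐ[volume] fun x => (w x : ℂ) * (c • f : L2 d) x := by
  filter_upwards [Lp.coeFn_smul c f] with x hx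
  rw [hx]
  simp only [Pi.smul_apply, smul_eq_mul, mul_left_comm]

/-- The maximal domain `{f ∈ L² | w f ∈ L²}` of the multiplication by `w`. -/
def mulDomain (w : Space d → ℝ) : Submodule ℂ (L2 d) where
  carrier := {f | MemLp (fun x => (w x : ℂ) * f x) 2 volume}
  zero_mem' := by
    refine (MemLp.zero' (ε := ℂ)).ae_eq ?_
    filter_upwards [Lp.coeFn_zero ℂ 2 (volume : Measure (Space d))] with x hx
    rw [hx]
    simp only [Pi.zero_apply, mul_zero]
  add_mem' := fun {f g} hf hg => (MemLp.add hf hg).ae_eq (mul_coeFn_add w f g)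
  smul_mem' := fun c f hf => (MemLp.const_smul hf c).ae_eq (mul_coeFn_smul w c f)

theorem memLp_of_mem_mulDomain {w : Space d → ℝ} (f : mulDomain w) :
    MemLp (fun x => (w x : ℂ) * (f : L2 d) x) 2 volume :=
  f.2

/-- Multiplication by a real function `w`, on its maximal domain `{f ∈ L² | w f ∈ L²}`. -/
def mulOp (w : Space d → ℝ) : L2 d →ₗ.[ℂ] L2 d where
  domain := mulDomain w
  toFun :=
    { toFun := fun f => MemLp.toLp (fun x => (w x : ℂ) * (f : L2 d) x) (memLp_of_mem_mulDomain f)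
      map_add' := by
        intro f g
        rw [← MemLp.toLp_add (memLp_of_mem_mulDomain f) (memLp_of_mem_mulDomain g)]
        exact MemLp.toLp_congr _ _ (mul_coeFn_add w f g).symm
      map_smul' := by
        intro c f
        rw [RingHom.id_apply, ← MemLp.toLp_const_smul c (memLp_of_mem_mulDomain f)]
        exact MemLp.toLp_congr _ _ (mul_coeFn_smul w c f).symm }

/-- The bracket `⟨x⟩ = (1 + |x|²)^{1/2}`. -/
def bracket (x : Space d) : ℝ := Real.sqrt (1 + ‖x‖ ^ 2)

/-- Multiplication by `e^{a⟨x⟩}` on its maximal domain in `L²(ℝᵈ)`. -/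
def expWeight (d : ℕ) (a : ℝ) : L2 d →ₗ.[ℂ] L2 d :=
  mulOp fun x => Real.exp (a * bracket x)

/-! ### The Schrödinger operator -/

/-- `V ∈ L^∞_loc(ℝᵈ)`. -/
def LocallyEssBounded (V : Space d → ℝ) : Prop :=
  ∀ S : Set (Space d), IsCompact S → MemLp V ∞ (volume.restrict S)

/-- A confining potential: `V ≥ 0`, `V ∈ L^∞_loc`, and the essential infimum of `V` outside the
ball of radius `R` about the origin tends to infinity as `R → ∞`. -/
structure IsConfining (V : Space d → ℝ) : Prop where
  nonneg : ∀ᵐ x, 0 ≤ V x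
  locallyEssBounded : LocallyEssBounded V
  tendsto_essInf : Tendsto
    (fun R : ℝ => essInf (fun x => (V x : EReal)) (volume.restrict (Metric.ball (0 : Space d) R)ᶜ))
    atTop (𝓝 ⊤)

/-- The space `C₀^∞(ℝᵈ)` of smooth, compactly supported, complex-valued functions. -/
def testFunctions (d : ℕ) : Submodule ℂ (Space d → ℂ) where
  carrier := {φ | ContDiff ℝ ∞ φ ∧ HasCompactSupport φ}
  zero_mem' := ⟨contDiff_const, HasCompactSupport.zero⟩
  add_mem' := fun h k => ⟨h.1.add k.1, h.2.add k.2⟩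
  smul_mem' := fun c _ h => ⟨contDiff_const.smul h.1, h.2.smul_left (f := fun _ => c)⟩

/-- The function `-Δφ + V φ`. -/
def schrodingerFun (V : Space d → ℝ) (φ : Space d → ℂ) : Space d → ℂ :=
  fun x => -(Laplacian.laplacian φ x) + (V x : ℂ) * φ x

theorem memLp_testFunction (φ : testFunctions d) :
    MemLp (φ : Space d → ℂ) 2 (volume : Measure (Space d)) :=
  φ.2.1.continuous.memLp_of_hasCompactSupport φ.2.2

theorem laplacian_testFunction (φ : testFunctions d) :
    Laplacian.laplacian (φ : Space d → ℂ) =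
      ⇑(Laplacian.laplacian (φ.2.2.toSchwartzMap φ.2.1)) := by
  ext x
  rw [SchwartzMap.laplacian_apply]
  rfl

theorem memLp_mul_testFunction {V : Space d → ℝ} (hV : LocallyEssBounded V)
    (φ : testFunctions d) :
    MemLp (fun x => (V x : ℂ) * (φ : Space d → ℂ) x) 2 (volume : Measure (Space d)) := by
  have h1 : MemLp (fun x => (V x : ℂ)) ∞ (volume.restrict (tsupport (φ : Space d → ℂ))) :=
    (hV _ φ.2.2).ofReal
  have h2 := MemLp.mul' (r := 2) ((memLp_testFunction φ).restrict (tsupport (φ : Space d → ℂ))) h1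
  rw [← memLp_indicator_iff_restrict (isClosed_tsupport _).measurableSet] at h2
  convert h2 using 1
  ext x
  by_cases hx : x ∈ tsupport (φ : Space d → ℂ)
  · rw [Set.indicator_of_mem hx]
  · rw [Set.indicator_of_notMem hx, image_eq_zero_of_notMem_tsupport hx, mul_zero]

theorem memLp_schrodingerFun {V : Space d → ℝ} (hV : LocallyEssBounded V)
    (φ : testFunctions d) :
    MemLp (schrodingerFun V φ) 2 (volume : Measure (Space d)) := by
  refine MemLp.add (MemLp.neg ?_) (memLp_mul_testFunction hV φ)
  rw [laplacian_testFunction]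
  exact SchwartzMap.memLp _ 2 volume

/-- The inclusion `C₀^∞(ℝᵈ) → L²(ℝᵈ)`. -/
def testToL2 (d : ℕ) : testFunctions d →ₗ[ℂ] L2 d where
  toFun φ := (memLp_testFunction φ).toLp φ
  map_add' φ ψ := MemLp.toLp_add (memLp_testFunction φ) (memLp_testFunction ψ)
  map_smul' c φ := MemLp.toLp_const_smul c (memLp_testFunction φ)

theorem testToL2_injective : Function.Injective (testToL2 d) := by
  intro φ ψ h
  have h' := (MemLp.toLp_eq_toLp_iff (memLp_testFunction φ) (memLp_testFunction ψ)).1 h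
  exact Subtype.ext ((φ.2.1.continuous.ae_eq_iff_eq volume ψ.2.1.continuous).1 h')

/-- The map `φ ↦ -Δφ + V φ` from `C₀^∞(ℝᵈ)` to `L²(ℝᵈ)`. -/
def schrodingerMap (V : Space d → ℝ) (hV : LocallyEssBounded V) : testFunctions d →ₗ[ℂ] L2 d where
  toFun φ := (memLp_schrodingerFun hV φ).toLp (schrodingerFun V φ)
  map_add' φ ψ := by
    rw [← MemLp.toLp_add]
    congr 1
    ext x
    have h : Laplacian.laplacian ((φ : Space d → ℂ) + ψ) x = _ :=
      ContDiffAt.laplacian_add (φ.2.1.contDiffAt.of_le (by norm_cast))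
        (ψ.2.1.contDiffAt.of_le (by norm_cast))
    simp only [schrodingerFun, Submodule.coe_add, h, Pi.add_apply]
    ring
  map_smul' c φ := by
    rw [RingHom.id_apply, ← MemLp.toLp_const_smul]
    congr 1
    ext x
    have h : Laplacian.laplacian (c • (φ : Space d → ℂ)) x = _ :=
      InnerProductSpace.laplacian_smul c (φ.2.1.contDiffAt.of_le (by norm_cast))
    simp only [schrodingerFun, Submodule.coe_smul, h, Pi.smul_apply, smul_eq_mul]
    ring

/-- The operator `-Δ + V` with domain `C₀^∞(ℝᵈ)`. -/
def minimalHamiltonian (V : Space d → ℝ) (hV : LocallyEssBounded V) : L2 d →ₗ.[ℂ] L2 d where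
  domain := LinearMap.range (testToL2 d)
  toFun := schrodingerMap V hV ∘ₗ (LinearEquiv.ofInjective (testToL2 d) testToL2_injective).symm

/-- The Hamiltonian `H = -Δ + V`: the closure of `-Δ + V` on `C₀^∞(ℝᵈ)`. When the latter is
essentially self-adjoint, as it is for `V ≥ 0`, this closure is its unique self-adjoint extension. -/
def hamiltonian (V : Space d → ℝ) (hV : LocallyEssBounded V) : L2 d →ₗ.[ℂ] L2 d :=
  (minimalHamiltonian V hV).closure

theorem minimalHamiltonian_apply {V : Space d → ℝ} (hV : LocallyEssBounded V)
    (φ : testFunctions d) (h : testToL2 d φ ∈ (minimalHamiltonian V hV).domain) :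
    minimalHamiltonian V hV ⟨testToL2 d φ, h⟩ = schrodingerMap V hV φ := by
  change schrodingerMap V hV
    ((LinearEquiv.ofInjective (testToL2 d) testToL2_injective).symm ⟨testToL2 d φ, h⟩) = _
  congr 1
  rw [LinearEquiv.symm_apply_eq]
  rfl

theorem dense_range_testToL2 : Dense (Set.range (testToL2 d)) := by
  intro f
  rw [Metric.mem_closure_iff]
  intro ε hε
  obtain ⟨g, hg₁, hg₂, hg₃⟩ := (Lp.memLp f).exist_eLpNorm_sub_le (p := 2) (by norm_num)
    (by norm_num) (half_pos hε)
  refine ⟨testToL2 d ⟨g, hg₂, hg₁⟩, Set.mem_range_self _, ?_⟩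
  have hg : MemLp g 2 volume := memLp_testFunction ⟨g, hg₂, hg₁⟩
  have h : testToL2 d ⟨g, hg₂, hg₁⟩ = hg.toLp g := rfl
  rw [h, Lp.dist_def]
  have h2 : eLpNorm (⇑f - ⇑(hg.toLp g)) 2 volume = eLpNorm (⇑f - g) 2 volume :=
    eLpNorm_congr_ae ((ae_eq_refl _).sub hg.coeFn_toLp)
  rw [h2]
  refine lt_of_le_of_lt (ENNReal.toReal_le_of_le_ofReal (half_pos hε).le hg₃) (half_lt_self hε)

theorem integrable_inner_of_memLp {f g : Space d → ℂ} (hf : MemLp f 2 volume)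
    (hg : MemLp g 2 volume) : Integrable (fun x => inner ℂ (f x) (g x)) volume := by
  refine (L2.integrable_inner (𝕜 := ℂ) (hf.toLp f) (hg.toLp g)).congr ?_
  filter_upwards [hf.coeFn_toLp, hg.coeFn_toLp] with x h1 h2
  rw [h1, h2]

/-- `-Δ + V` is symmetric on `C₀^∞(ℝᵈ)`. -/
theorem inner_schrodingerMap {V : Space d → ℝ} (hV : LocallyEssBounded V)
    (φ ψ : testFunctions d) :
    inner ℂ (schrodingerMap V hV φ) (testToL2 d ψ) =
      inner ℂ (testToL2 d φ) (schrodingerMap V hV ψ) := by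
  let f := φ.2.2.toSchwartzMap φ.2.1
  let g := ψ.2.2.toSchwartzMap ψ.2.1
  have key := SchwartzMap.integral_bilinear_laplacian_right_eq_left (μ := volume) f g
    ((ContinuousLinearMap.mul ℝ ℂ).comp (Complex.conjCLE : ℂ →L[ℝ] ℂ))
  have hΔ (χ : testFunctions d) : MemLp (Laplacian.laplacian (χ : Space d → ℂ)) 2 volume := by
    rw [laplacian_testFunction]
    exact SchwartzMap.memLp _ 2 volume
  have i1 : Integrable (fun x => inner ℂ (Laplacian.laplacian (φ : Space d → ℂ) x)
      ((ψ : Space d → ℂ) x)) volume := integrable_inner_of_memLp (hΔ φ) (memLp_testFunction ψ)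
  have i2 : Integrable (fun x => inner ℂ ((φ : Space d → ℂ) x)
      (Laplacian.laplacian (ψ : Space d → ℂ) x)) volume :=
    integrable_inner_of_memLp (memLp_testFunction φ) (hΔ ψ)
  have i3 : Integrable (fun x => inner ℂ ((V x : ℂ) * (φ : Space d → ℂ) x)
      ((ψ : Space d → ℂ) x)) volume :=
    integrable_inner_of_memLp (memLp_mul_testFunction hV φ) (memLp_testFunction ψ)
  have i4 : Integrable (fun x => inner ℂ ((φ : Space d → ℂ) x)
      ((V x : ℂ) * (ψ : Space d → ℂ) x)) volume :=
    integrable_inner_of_memLp (memLp_testFunction φ) (memLp_mul_testFunction hV ψ)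
  have e1 : inner ℂ (schrodingerMap V hV φ) (testToL2 d ψ) =
      ∫ x, inner ℂ (schrodingerFun V φ x) ((ψ : Space d → ℂ) x) := by
    rw [L2.inner_def]
    refine integral_congr_ae ?_
    filter_upwards [(memLp_schrodingerFun hV φ).coeFn_toLp, (memLp_testFunction ψ).coeFn_toLp]
      with x h1 h2
    exact congrArg₂ (inner ℂ) h1 h2
  have e2 : inner ℂ (testToL2 d φ) (schrodingerMap V hV ψ) =
      ∫ x, inner ℂ ((φ : Space d → ℂ) x) (schrodingerFun V ψ x) := by
    rw [L2.inner_def]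
    refine integral_congr_ae ?_
    filter_upwards [(memLp_schrodingerFun hV ψ).coeFn_toLp, (memLp_testFunction φ).coeFn_toLp]
      with x h1 h2
    exact congrArg₂ (inner ℂ) h2 h1
  have key' : ∫ x, inner ℂ ((φ : Space d → ℂ) x) (Laplacian.laplacian (ψ : Space d → ℂ) x) =
      ∫ x, inner ℂ (Laplacian.laplacian (φ : Space d → ℂ) x) ((ψ : Space d → ℂ) x) := by
    rw [laplacian_testFunction, laplacian_testFunction]
    simpa [f, g, mul_comm] using key
  rw [e1, e2]
  simp only [schrodingerFun, inner_add_left, inner_add_right, inner_neg_left, inner_neg_right]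
  refine (integral_add i1.neg i3).trans (Eq.trans ?_ (integral_add i2.neg i4).symm)
  simp only [Pi.neg_apply]
  rw [integral_neg, integral_neg, key']
  congr 2
  ext x
  simp
  ring

/-- `-Δ + V` on `C₀^∞(ℝᵈ)` is closable, so `hamiltonian V hV` is a closed operator. -/
theorem minimalHamiltonian_isClosable {V : Space d → ℝ} (hV : LocallyEssBounded V) :
    (minimalHamiltonian V hV).IsClosable := by
  have hd : Dense ((minimalHamiltonian V hV).domain : Set (L2 d)) := by
    change Dense ((LinearMap.range (testToL2 d) : Submodule ℂ (L2 d)) : Set (L2 d))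
    rw [LinearMap.coe_range]
    exact dense_range_testToL2
  have hs : (minimalHamiltonian V hV).IsFormalAdjoint (minimalHamiltonian V hV) := by
    rintro ⟨_, φ, rfl⟩ ⟨_, ψ, rfl⟩
    refine (congrArg (inner ℂ · _) (minimalHamiltonian_apply hV φ _)).trans
      (Eq.trans ?_ (congrArg (inner ℂ _) (minimalHamiltonian_apply hV ψ _)).symm)
    exact inner_schrodingerMap hV φ ψ
  exact LinearPMap.isClosable_iff_exists_closed_extension.2
    ⟨_, LinearPMap.adjoint_isClosed hd, hs.le_adjoint hd⟩

end

end ConfiningSchrodinger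

namespace ConfiningSchrodinger

open MeasureTheory Filter Topology
open scoped ENNReal ContDiff InnerProductSpace

noncomputable section

variable {d : ℕ}

/-! ### Bounded multiplication operators -/

/-! This is a Combes–Thomas argument. For smooth real `g` and a test function `φ`, put `ψ = e^g φ`.
Conjugation by `e^g` perturbs `H - z` only at first order: `(H - z)ψ = e^g (H - z)φ - ∑ᵢ (2 ∂ᵢg ∂ᵢψ
+ (∂ᵢ²g - (∂ᵢg)²) ψ)` (`schrodingerFun_exp_mul`). Write `N = ‖(H - z)ψ‖`. On `K` there is a uniform
bound `‖ψ‖ ≤ C N`, by compactness (`exists_bound_of_isCompact_subset_resolventSet`). Since `V ≥ 0`,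
the energy inequality `energy_le` then bounds each `‖∂ᵢψ‖` by a multiple of `N`. If the derivatives
of `g` are `O(κ)` with `κ` small, the perturbation is at most `N / 2` and is absorbed, leaving `‖e^g
φ‖ ≤ 2C ‖e^g (H - z)φ‖` (`norm_exp_boundedMul_le`).

The weight `e^{κ⟨x⟩}` is unbounded, so `g` is taken to be `κ⟨x⟩ / (1 + ε⟨x⟩)`: it is bounded for
each `ε > 0`, and its derivatives are controlled uniformly in `ε`. Boundedness of `e^g` carries the
estimate from test functions to the domain of the closure. For `u = (H - z)⁻¹ e^{-κ⟨x⟩} f` the right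
side is at most `2C ‖f‖`, because `g ≤ κ⟨x⟩`. Fatou's lemma as `ε → 0` finishes the proof
(`memLp_exp_bracket_mul`). -/

theorem memLp_mul_of_bounded {w : Space d → ℝ} (hw : Continuous w) {B : ℝ}
    (hB : ∀ x, |w x| ≤ B) (f : L2 d) : MemLp (fun x => (w x : ℂ) * f x) 2 volume := by
  refine (Lp.memLp f).of_le_mul (c := B)
    ((Complex.continuous_ofReal.comp hw).aestronglyMeasurable.mul (Lp.aestronglyMeasurable f))
    (Eventually.of_forall fun x => ?_)
  rw [norm_mul, Complex.norm_real]
  exact mul_le_mul_of_nonneg_right (hB x) (norm_nonneg _)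

theorem mem_mulDomain_of_bounded {w : Space d → ℝ} (hw : Continuous w) {B : ℝ}
    (hB : ∀ x, |w x| ≤ B) (f : L2 d) : f ∈ mulDomain w :=
  memLp_mul_of_bounded hw hB f

theorem mulOp_coeFn (w : Space d → ℝ) (f : mulDomain w) :
    mulOp w f =ᵐ[volume] fun x => (w x : ℂ) * (f : L2 d) x :=
  (memLp_of_mem_mulDomain f).coeFn_toLp

/-- Multiplication by a bounded continuous real function, as a bounded operator on `L²(ℝᵈ)`. -/
def boundedMul (w : Space d → ℝ) (hw : Continuous w) (B : ℝ) (hB : ∀ x, |w x| ≤ B) :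
    L2 d →L[ℂ] L2 d :=
  LinearMap.mkContinuous
    ((mulOp w).toFun ∘ₗ LinearMap.codRestrict (mulDomain w) LinearMap.id
      (mem_mulDomain_of_bounded hw hB)) B (by
    intro f
    refine Lp.norm_le_mul_norm_of_ae_le_mul ?_
    filter_upwards [mulOp_coeFn w ⟨f, mem_mulDomain_of_bounded hw hB f⟩] with x hx
    refine (congrArg norm hx).trans_le ?_
    rw [norm_mul, Complex.norm_real]
    exact mul_le_mul_of_nonneg_right (hB x) (norm_nonneg _))

theorem boundedMul_coeFn {w : Space d → ℝ} (hw : Continuous w) {B : ℝ} (hB : ∀ x, |w x| ≤ B)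
    (f : L2 d) : boundedMul w hw B hB f =ᵐ[volume] fun x => (w x : ℂ) * f x :=
  mulOp_coeFn w ⟨f, mem_mulDomain_of_bounded hw hB f⟩

theorem norm_boundedMul_le {w : Space d → ℝ} (hw : Continuous w) {B : ℝ} (hB : ∀ x, |w x| ≤ B)
    (f : L2 d) : ‖boundedMul w hw B hB f‖ ≤ B * ‖f‖ := by
  have h0 : 0 ≤ B := (abs_nonneg _).trans (hB 0)
  refine Lp.norm_le_mul_norm_of_ae_le_mul ?_
  filter_upwards [boundedMul_coeFn hw hB f] with x hx
  rw [hx, norm_mul, Complex.norm_real]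
  exact mul_le_mul_of_nonneg_right (hB x) (norm_nonneg _)

/-! ### Calculus for test functions -/

/-- The partial derivative in the `i`-th coordinate direction. -/
def partialDeriv {F : Type*} [NormedAddCommGroup F] [NormedSpace ℝ F] (i : Fin d)
    (f : Space d → F) : Space d → F :=
  fun x => fderiv ℝ f x (EuclideanSpace.basisFun (Fin d) ℝ i)

theorem contDiff_partialDeriv {F : Type*} [NormedAddCommGroup F] [NormedSpace ℝ F] (i : Fin d)
    {f : Space d → F} (hf : ContDiff ℝ ∞ f) : ContDiff ℝ ∞ (partialDeriv i f) :=
  (hf.fderiv_right (m := ∞) (by simp)).clm_apply contDiff_const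

/-- The partial derivative of a test function. -/
def derivTest (i : Fin d) (φ : testFunctions d) : testFunctions d :=
  ⟨partialDeriv i φ, contDiff_partialDeriv i φ.2.1, φ.2.2.fderiv_apply ℝ _⟩

/-- The product of a test function with a smooth real function. -/
def mulTest (w : Space d → ℝ) (hw : ContDiff ℝ ∞ w) (φ : testFunctions d) : testFunctions d :=
  ⟨fun x => (w x : ℂ) * (φ : Space d → ℂ) x,
    (Complex.ofRealCLM.contDiff.comp hw).mul φ.2.1, φ.2.2.mul_left⟩

theorem testToL2_coeFn (φ : testFunctions d) :
    testToL2 d φ =ᵐ[volume] (φ : Space d → ℂ) :=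
  (memLp_testFunction φ).coeFn_toLp

theorem schrodingerMap_coeFn {V : Space d → ℝ} (hV : LocallyEssBounded V) (φ : testFunctions d) :
    schrodingerMap V hV φ =ᵐ[volume] schrodingerFun V φ :=
  (memLp_schrodingerFun hV φ).coeFn_toLp

theorem laplacian_testFunction_eq_sum (φ : testFunctions d) (x : Space d) :
    Laplacian.laplacian (φ : Space d → ℂ) x =
      ∑ i, partialDeriv i (partialDeriv i (φ : Space d → ℂ)) x := by
  rw [laplacian_testFunction,
    SchwartzMap.laplacian_eq_sum (EuclideanSpace.basisFun (Fin d) ℝ), sum_apply]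
  refine Finset.sum_congr rfl fun i _ => ?_
  rw [SchwartzMap.lineDerivOp_apply_eq_fderiv]
  rfl

theorem partialDeriv_exp_mul {g : Space d → ℝ} (hg : Differentiable ℝ g) {f : Space d → ℂ}
    (hf : Differentiable ℝ f) (i : Fin d) :
    partialDeriv i (fun x => (Real.exp (g x) : ℂ) * f x) = fun x =>
      ((partialDeriv i g x : ℝ) : ℂ) * ((Real.exp (g x) : ℂ) * f x) +
        (Real.exp (g x) : ℂ) * partialDeriv i f x := by
  ext x
  have h1 : HasFDerivAt (fun x => (Real.exp (g x) : ℂ))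
      (Complex.ofRealCLM.comp (Real.exp (g x) • fderiv ℝ g x)) x :=
    Complex.ofRealCLM.hasFDerivAt.comp x (hg x).hasFDerivAt.exp
  have h2 : HasFDerivAt (fun x => (Real.exp (g x) : ℂ) * f x) _ x := h1.mul (hf x).hasFDerivAt
  simp only [partialDeriv]
  rw [h2.fderiv]
  simp
  ring

theorem partialDeriv_ofReal_mul {g : Space d → ℝ} (hg : Differentiable ℝ g) {f : Space d → ℂ}
    (hf : Differentiable ℝ f) (i : Fin d) :
    partialDeriv i (fun x => (g x : ℂ) * f x) = fun x =>
      ((partialDeriv i g x : ℝ) : ℂ) * f x + (g x : ℂ) * partialDeriv i f x := by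
  ext x
  have h1 : HasFDerivAt (fun x => (g x : ℂ)) (Complex.ofRealCLM.comp (fderiv ℝ g x)) x :=
    Complex.ofRealCLM.hasFDerivAt.comp x (hg x).hasFDerivAt
  have h2 : HasFDerivAt (fun x => (g x : ℂ) * f x) _ x := h1.mul (hf x).hasFDerivAt
  simp only [partialDeriv]
  rw [h2.fderiv]
  simp
  ring

theorem partialDeriv_add {f g : Space d → ℂ} (hf : Differentiable ℝ f) (hg : Differentiable ℝ g)
    (i : Fin d) :
    partialDeriv i (fun x => f x + g x) = fun x => partialDeriv i f x + partialDeriv i g x := by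
  ext x
  have h : HasFDerivAt (fun x => f x + g x) _ x := (hf x).hasFDerivAt.add (hg x).hasFDerivAt
  simp only [partialDeriv]
  rw [h.fderiv]
  rfl

/-- The first-order term is written with the derivative of `e^g f` rather than of `f`, because that
is the quantity the energy inequality controls. This choice turns `+(∂ᵢg)²` into `-(∂ᵢg)²`. -/
theorem partialDeriv_partialDeriv_exp_mul {g : Space d → ℝ} (hg : ContDiff ℝ ∞ g)
    {f : Space d → ℂ} (hf : ContDiff ℝ ∞ f) (i : Fin d) (x : Space d) :
    partialDeriv i (partialDeriv i (fun x => (Real.exp (g x) : ℂ) * f x)) x =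
      (Real.exp (g x) : ℂ) * partialDeriv i (partialDeriv i f) x +
      (2 * ((partialDeriv i g x : ℝ) : ℂ) *
          partialDeriv i (fun x => (Real.exp (g x) : ℂ) * f x) x +
        ((partialDeriv i (partialDeriv i g) x - partialDeriv i g x ^ 2 : ℝ) : ℂ) *
          ((Real.exp (g x) : ℂ) * f x)) := by
  have hi : (∞ : WithTop ℕ∞) ≠ 0 := by simp
  have hg0 := hg.differentiable hi
  have hf0 := hf.differentiable hi
  have hg1 := (contDiff_partialDeriv i hg).differentiable hi
  have hf1 := (contDiff_partialDeriv i hf).differentiable hi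
  have he : ContDiff ℝ ∞ fun x => (Real.exp (g x) : ℂ) :=
    Complex.ofRealCLM.contDiff.comp hg.exp
  have he0 := (he.mul hf).differentiable hi
  have hd1 : Differentiable ℝ fun x => ((partialDeriv i g x : ℝ) : ℂ) * ((Real.exp (g x) : ℂ) * f x) :=
    (Complex.ofRealCLM.differentiable.comp hg1).mul he0
  have hd2 : Differentiable ℝ fun x => (Real.exp (g x) : ℂ) * partialDeriv i f x :=
    (he.differentiable hi).mul hf1
  conv_lhs => rw [partialDeriv_exp_mul hg0 hf0, partialDeriv_add hd1 hd2,
    partialDeriv_ofReal_mul hg1 he0, partialDeriv_exp_mul hg0 hf1]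
  rw [partialDeriv_exp_mul hg0 hf0]
  push_cast
  ring

theorem schrodingerFun_exp_mul (V : Space d → ℝ) {g : Space d → ℝ} (hg : ContDiff ℝ ∞ g)
    (φ : testFunctions d) (x : Space d) :
    schrodingerFun V (mulTest (fun x => Real.exp (g x)) hg.exp φ) x =
      (Real.exp (g x) : ℂ) * schrodingerFun V φ x -
      ∑ i, (2 * ((partialDeriv i g x : ℝ) : ℂ) *
          (derivTest i (mulTest (fun x => Real.exp (g x)) hg.exp φ) : Space d → ℂ) x +
        ((partialDeriv i (partialDeriv i g) x - partialDeriv i g x ^ 2 : ℝ) : ℂ) *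
          (mulTest (fun x => Real.exp (g x)) hg.exp φ : Space d → ℂ) x) := by
  have h : Laplacian.laplacian
      (mulTest (fun x => Real.exp (g x)) hg.exp φ : Space d → ℂ) x =
      ∑ i, ((Real.exp (g x) : ℂ) * partialDeriv i (partialDeriv i (φ : Space d → ℂ)) x + _) :=
    (laplacian_testFunction_eq_sum _ x).trans (Finset.sum_congr rfl fun i _ =>
      partialDeriv_partialDeriv_exp_mul hg φ.2.1 i x)
  rw [Finset.sum_add_distrib, ← Finset.mul_sum, ← laplacian_testFunction_eq_sum] at h
  simp only [schrodingerFun]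
  rw [h]
  simp only [derivTest, mulTest]
  ring

/-! ### The energy inequality -/

/-- Integration by parts for Schwartz functions, with the real-bilinear form `(a, b) ↦ conj a * b`
standing in for the complex inner product. -/
theorem integral_inner_partialDeriv (φ : testFunctions d) (i : Fin d) :
    inner ℂ (testToL2 d (derivTest i (derivTest i φ))) (testToL2 d φ) =
      -((‖testToL2 d (derivTest i φ)‖ ^ 2 : ℝ) : ℂ) := by
  have hi (χ ψ : testFunctions d) : inner ℂ (testToL2 d χ) (testToL2 d ψ) =
      ∫ x, inner ℂ ((χ : Space d → ℂ) x) ((ψ : Space d → ℂ) x) := by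
    rw [L2.inner_def]
    refine integral_congr_ae ?_
    filter_upwards [testToL2_coeFn χ, testToL2_coeFn ψ] with x h1 h2
    rw [h1, h2]
  have key := SchwartzMap.integral_bilinear_lineDerivOp_right_eq_neg_left (μ := volume)
    ((derivTest i φ).2.2.toSchwartzMap (derivTest i φ).2.1) (φ.2.2.toSchwartzMap φ.2.1)
    ((ContinuousLinearMap.mul ℝ ℂ).comp (Complex.conjCLE : ℂ →L[ℝ] ℂ))
    (EuclideanSpace.basisFun (Fin d) ℝ i)
  have key' : ∫ x, inner ℂ ((derivTest i φ : Space d → ℂ) x) ((derivTest i φ : Space d → ℂ) x) =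
      -∫ x, inner ℂ ((derivTest i (derivTest i φ) : Space d → ℂ) x) ((φ : Space d → ℂ) x) := by
    simp only [SchwartzMap.lineDerivOp_apply_eq_fderiv] at key
    simp only [RCLike.inner_apply']
    exact key
  rw [hi, ← neg_eq_iff_eq_neg, ← key', ← hi, inner_self_eq_norm_sq_to_K]
  norm_cast

/-- Integrating by parts, `Re ⟨Hφ, φ⟩` is the gradient energy plus `∫ V |φ|²`, and the latter is
nonnegative. -/
theorem energy_le {V : Space d → ℝ} (hV : LocallyEssBounded V) (h0 : ∀ᵐ x, 0 ≤ V x)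
    (φ : testFunctions d) :
    ∑ i, ‖testToL2 d (derivTest i φ)‖ ^ 2 ≤
      (inner ℂ (schrodingerMap V hV φ) (testToL2 d φ)).re := by
  have hm := memLp_mul_testFunction hV φ
  have e : schrodingerMap V hV φ =
      -(∑ i, testToL2 d (derivTest i (derivTest i φ))) + hm.toLp _ := by
    have hs : (∑ i, testToL2 d (derivTest i (derivTest i φ))) =
        testToL2 d (∑ i, derivTest i (derivTest i φ)) := (map_sum _ _ _).symm
    rw [hs]
    refine Lp.ext ?_
    filter_upwards [schrodingerMap_coeFn hV φ, Lp.coeFn_add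
      (-(testToL2 d (∑ i, derivTest i (derivTest i φ)))) (hm.toLp _),
      Lp.coeFn_neg (testToL2 d (∑ i, derivTest i (derivTest i φ))),
      testToL2_coeFn (∑ i, derivTest i (derivTest i φ)), hm.coeFn_toLp] with x h1 h2 h3 h4 h5
    rw [h1, h2, Pi.add_apply, h3, Pi.neg_apply, h4, h5, schrodingerFun,
      laplacian_testFunction_eq_sum, Submodule.coe_sum, Finset.sum_apply]
    rfl
  have hp : 0 ≤ (inner ℂ (hm.toLp _) (testToL2 d φ)).re := by
    rw [L2.inner_def]
    have hint := L2.integrable_inner (𝕜 := ℂ) (hm.toLp _) (testToL2 d φ)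
    have hre : (∫ x, inner ℂ (hm.toLp _ x) (testToL2 d φ x)).re =
      ∫ x, (inner ℂ (hm.toLp _ x) (testToL2 d φ x) : ℂ).re := (integral_re hint).symm
    rw [hre]
    refine integral_nonneg_of_ae ?_
    filter_upwards [hm.coeFn_toLp, testToL2_coeFn φ, h0] with x h1 h2 h3
    rw [h1, h2]
    simp only [Pi.zero_apply, RCLike.inner_apply, map_mul, Complex.conj_ofReal]
    rw [mul_left_comm, Complex.mul_conj, ← Complex.ofReal_mul, Complex.ofReal_re]
    exact mul_nonneg h3 (Complex.normSq_nonneg _)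
  rw [e, inner_add_left, inner_neg_left, sum_inner]
  simp only [integral_inner_partialDeriv, Finset.sum_neg_distrib, neg_neg]
  rw [Complex.add_re, ← Complex.ofReal_sum, Complex.ofReal_re]
  linarith

/-! ### The regularized exponents -/

theorem one_le_bracket (x : Space d) : 1 ≤ bracket x :=
  Real.one_le_sqrt.2 (by nlinarith [sq_nonneg ‖x‖])

theorem bracket_sq (x : Space d) : bracket x ^ 2 = 1 + ‖x‖ ^ 2 :=
  Real.sq_sqrt (by positivity)

theorem contDiff_bracket : ContDiff ℝ ∞ (bracket : Space d → ℝ) :=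
  (contDiff_const.add (contDiff_norm_sq ℝ)).sqrt fun x => by positivity

theorem sq_coord_le (x : Space d) (i : Fin d) : x i ^ 2 ≤ bracket x ^ 2 := by
  rw [bracket_sq, EuclideanSpace.real_norm_sq_eq]
  have := Finset.single_le_sum (f := fun j => x j ^ 2) (fun j _ => sq_nonneg _) (Finset.mem_univ i)
  simp only at this
  linarith

/-- Reduces the derivatives of the exponent to one-variable calculus along a coordinate line. -/
theorem partialDeriv_eq_of_hasDerivAt {f : Space d → ℝ} {x : Space d} {i : Fin d} {c : ℝ}
    (hf : DifferentiableAt ℝ f x)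
    (h : HasDerivAt (fun t : ℝ => f (x + t • EuclideanSpace.basisFun (Fin d) ℝ i)) c 0) :
    partialDeriv i f x = c := by
  have h' : HasLineDerivAt ℝ f c x (EuclideanSpace.basisFun (Fin d) ℝ i) := h
  exact (hf.hasFDerivAt.hasLineDerivAt _).unique h'

theorem hasDerivAt_coord_line (x : Space d) (i : Fin d) :
    HasDerivAt (fun t : ℝ => (x + t • EuclideanSpace.basisFun (Fin d) ℝ i) i) 1 0 := by
  simpa using (hasDerivAt_id (0 : ℝ)).const_add (x i)

theorem hasDerivAt_bracket_line (x : Space d) (i : Fin d) :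
    HasDerivAt (fun t : ℝ => bracket (x + t • EuclideanSpace.basisFun (Fin d) ℝ i))
      (x i / bracket x) 0 := by
  have h1 : HasDerivAt (fun t : ℝ => x + t • EuclideanSpace.basisFun (Fin d) ℝ i)
      (EuclideanSpace.basisFun (Fin d) ℝ i) 0 := by
    simpa using ((hasDerivAt_id (0 : ℝ)).smul_const (EuclideanSpace.basisFun (Fin d) ℝ i)).const_add x
  have h2 := (h1.norm_sq.const_add 1).sqrt (by positivity)
  have e : x + (0 : ℝ) • EuclideanSpace.basisFun (Fin d) ℝ i = x := by rw [zero_smul, add_zero]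
  rw [e] at h2
  refine h2.congr_deriv ?_
  rw [EuclideanSpace.inner_basisFun_real, mul_div_mul_left _ _ two_ne_zero]
  rfl

/-- The bounded exponent `κ⟨x⟩ / (1 + ε⟨x⟩)`. -/
def regExponent (d : ℕ) (κ ε : ℝ) (x : Space d) : ℝ :=
  κ * bracket x / (1 + ε * bracket x)

section

variable {κ ε : ℝ}

theorem one_le_regDenom (hε : 0 ≤ ε) (x : Space d) : 1 ≤ 1 + ε * bracket x := by
  have := one_le_bracket x
  have : 0 ≤ ε * bracket x := by positivity
  linarith

theorem contDiff_regExponent (hε : 0 ≤ ε) : ContDiff ℝ ∞ (regExponent d κ ε) :=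
  (contDiff_const.mul contDiff_bracket).div (contDiff_const.add (contDiff_const.mul contDiff_bracket))
    fun x => (zero_lt_one.trans_le (one_le_regDenom hε x)).ne'

theorem regExponent_le_bracket (hκ : 0 ≤ κ) (hε : 0 ≤ ε) (x : Space d) :
    regExponent d κ ε x ≤ κ * bracket x := by
  have := one_le_bracket x
  exact div_le_self (by positivity) (one_le_regDenom hε x)

theorem regExponent_le_div (hκ : 0 ≤ κ) (hε : 0 < ε) (x : Space d) :
    regExponent d κ ε x ≤ κ / ε := by
  have := one_le_bracket x
  rw [regExponent, div_le_div_iff₀ (by positivity) hε]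
  nlinarith

theorem partialDeriv_regExponent (hε : 0 ≤ ε) (i : Fin d) :
    partialDeriv i (regExponent d κ ε) =
      fun x => κ * (x i / bracket x) / (1 + ε * bracket x) ^ 2 := by
  ext x
  have hD := zero_lt_one.trans_le (one_le_regDenom hε x)
  refine partialDeriv_eq_of_hasDerivAt
    ((contDiff_regExponent hε).differentiable (by simp) x) ?_
  have hb := hasDerivAt_bracket_line x i
  have h := (hb.const_mul κ).div ((hb.const_mul ε).const_add 1) (by simpa using hD.ne')
  refine h.congr_deriv ?_
  simp only [zero_smul, add_zero]
  field_simp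
  ring

theorem abs_coord_div_bracket_le (x : Space d) (i : Fin d) : |x i / bracket x| ≤ 1 := by
  have hb := one_le_bracket x
  rw [abs_div, abs_of_pos (by linarith : 0 < bracket x)]
  exact div_le_one_of_le₀ (abs_le_of_sq_le_sq (sq_coord_le x i) (by linarith))
    (by linarith)

/-- Regularizing only adds denominators that are at least `1`, so the bound is independent of `ε`.
-/
theorem abs_partialDeriv_regExponent_le (hκ : 0 ≤ κ) (hε : 0 ≤ ε) (i : Fin d) (x : Space d) :
    |partialDeriv i (regExponent d κ ε) x| ≤ κ := by
  have hD := one_le_regDenom hε x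
  rw [partialDeriv_regExponent hε, abs_div, abs_mul, abs_of_nonneg hκ, abs_of_pos (a := _ ^ 2)
    (by positivity)]
  refine (div_le_self (by positivity) (one_le_pow₀ hD)).trans ?_
  exact mul_le_of_le_one_right hκ (abs_coord_div_bracket_le x i)

theorem partialDeriv_partialDeriv_regExponent (hε : 0 ≤ ε) (i : Fin d) (x : Space d) :
    partialDeriv i (partialDeriv i (regExponent d κ ε)) x =
      κ * ((1 - (x i / bracket x) ^ 2) / (bracket x * (1 + ε * bracket x) ^ 2) -
        2 * ε * (x i / bracket x) ^ 2 / (1 + ε * bracket x) ^ 3) := by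
  have hD := zero_lt_one.trans_le (one_le_regDenom hε x)
  have hb0 := zero_lt_one.trans_le (one_le_bracket x)
  refine partialDeriv_eq_of_hasDerivAt
    ((contDiff_partialDeriv i (contDiff_regExponent hε)).differentiable (by simp) x) ?_
  rw [partialDeriv_regExponent hε]
  have hb := hasDerivAt_bracket_line x i
  have h := (((hasDerivAt_coord_line x i).div hb (by simpa using hb0.ne')).const_mul κ).div
    (((hb.const_mul ε).const_add 1).pow 2) (by simpa using hD.ne')
  refine h.congr_deriv ?_
  simp only [Pi.div_apply, Pi.pow_apply, zero_smul, add_zero]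
  field_simp
  ring

theorem abs_partialDeriv_partialDeriv_regExponent_le (hκ : 0 ≤ κ) (hε : 0 ≤ ε) (hε1 : ε ≤ 1)
    (i : Fin d) (x : Space d) :
    |partialDeriv i (partialDeriv i (regExponent d κ ε)) x| ≤ 2 * κ := by
  have hD := one_le_regDenom hε x
  have hb := one_le_bracket x
  have hq : (x i / bracket x) ^ 2 ≤ 1 := (sq_le_one_iff_abs_le_one _).2 (abs_coord_div_bracket_le x i)
  have hq0 := sq_nonneg (x i / bracket x)
  rw [partialDeriv_partialDeriv_regExponent hε, abs_mul, abs_of_nonneg hκ, mul_comm 2 κ]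
  refine mul_le_mul_of_nonneg_left ?_ hκ
  have h1 : (1 - (x i / bracket x) ^ 2) / (bracket x * (1 + ε * bracket x) ^ 2) ≤ 1 :=
    (div_le_self (by linarith) (one_le_mul_of_one_le_of_one_le hb (one_le_pow₀ hD))).trans
      (by linarith)
  have h1' : 0 ≤ (1 - (x i / bracket x) ^ 2) / (bracket x * (1 + ε * bracket x) ^ 2) :=
    div_nonneg (by linarith) (by positivity)
  have h2 : 2 * ε * (x i / bracket x) ^ 2 / (1 + ε * bracket x) ^ 3 ≤ 2 :=
    (div_le_self (by positivity) (one_le_pow₀ hD)).trans (by nlinarith)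
  have h2' : 0 ≤ 2 * ε * (x i / bracket x) ^ 2 / (1 + ε * bracket x) ^ 3 := by positivity
  -- Both terms are nonnegative, so their difference is bounded by the larger of the two bounds, `1`
  -- and `2`.
  rw [abs_le]
  constructor <;> linarith

end

/-! ### Unbounded operators -/

section UnboundedOperators

variable {X : Type*} [NormedAddCommGroup X] [InnerProductSpace ℂ X]

/-- The inverse bound at a point survives, with a factor `2`, on a small ball around it. Compactness
makes it uniform without any continuity of the resolvent. -/
theorem exists_bound_of_isCompact_subset_resolventSet {A : X →ₗ.[ℂ] X} {K : Set ℂ}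
    (hK : IsCompact K) (hKρ : K ⊆ resolventSet A) :
    ∃ C : ℝ, 1 ≤ C ∧ ∀ z ∈ K, ∀ u : A.domain, ‖(u : X)‖ ≤ C * ‖A u - z • (u : X)‖ := by
  refine hK.induction_on (p := fun S => ∃ C : ℝ, 1 ≤ C ∧ ∀ z ∈ S, ∀ u : A.domain,
    ‖(u : X)‖ ≤ C * ‖A u - z • (u : X)‖) ⟨1, le_rfl, by simp⟩ ?_ ?_ ?_
  · rintro S T hST ⟨C, hC, h⟩
    exact ⟨C, hC, fun z hz => h z (hST hz)⟩
  · rintro S T ⟨C, hC, h⟩ ⟨C', hC', h'⟩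
    refine ⟨max C C', hC.trans (le_max_left _ _), ?_⟩
    rintro z (hz | hz) u
    · exact (h z hz u).trans (mul_le_mul_of_nonneg_right (le_max_left _ _) (norm_nonneg _))
    · exact (h' z hz u).trans (mul_le_mul_of_nonneg_right (le_max_right _ _) (norm_nonneg _))
  · intro z₀ hz₀
    obtain ⟨R, -, hR⟩ := hKρ hz₀
    have hc : 0 < 1 + ‖R‖ := by positivity
    -- The radius makes `(1 + ‖R‖) |z - z₀| < 1/2`, so half of `‖u‖` can be absorbed. Using `1 +
    -- ‖R‖` avoids dividing by zero and keeps the constant at least `1`.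
    refine ⟨Metric.ball z₀ (1 / (2 * (1 + ‖R‖))),
      mem_nhdsWithin_of_mem_nhds (Metric.ball_mem_nhds _ (by positivity)), 2 * (1 + ‖R‖),
      by linarith [norm_nonneg R], ?_⟩
    intro z hz u
    have hz' : ‖z - z₀‖ * (2 * (1 + ‖R‖)) < 1 := by
      rw [mem_ball_iff_norm, lt_div_iff₀ (by positivity)] at hz
      exact hz
    have h1 : ‖(u : X)‖ ≤ (1 + ‖R‖) * ‖A u - z₀ • (u : X)‖ := by
      conv_lhs => rw [← hR u]
      exact (R.le_opNorm _).trans (mul_le_mul_of_nonneg_right (by linarith) (norm_nonneg _))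
    have h2 : ‖A u - z₀ • (u : X)‖ ≤ ‖A u - z • (u : X)‖ + ‖z - z₀‖ * ‖(u : X)‖ := by
      rw [← norm_smul]
      refine le_trans (le_of_eq ?_) (norm_add_le _ _)
      congr 1
      rw [sub_smul]
      abel
    have h3 := mul_le_mul_of_nonneg_right hz'.le (norm_nonneg (u : X))
    have h4 := mul_le_mul_of_nonneg_left h2 hc.le
    linarith

theorem resolvent_spec {A : X →ₗ.[ℂ] X} {z : ℂ} (hz : z ∈ resolventSet A) :
    IsResolventAt A z (resolvent A z) := by
  have h : ∃ R : X →L[ℂ] X, IsResolventAt A z R := hz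
  rw [resolvent, dif_pos h]
  exact h.choose_spec

theorem mem_pcomp_domain {B A : X →ₗ.[ℂ] X} {u : X} (h : u ∈ A.domain)
    (h' : A ⟨u, h⟩ ∈ B.domain) : u ∈ (pcomp B A).domain :=
  ⟨⟨u, h⟩, h', rfl⟩

theorem exists_eq_ofBounded {P : X →ₗ.[ℂ] X} (hP : ∀ u, u ∈ P.domain) {M : ℝ} (hM : 0 ≤ M)
    (hb : ∀ u : P.domain, ‖P u‖ ≤ M * ‖(u : X)‖) :
    ∃ T : X →L[ℂ] X, P = ofBounded T ∧ ‖T‖ ≤ M := by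
  refine ⟨LinearMap.mkContinuous (P.toFun ∘ₗ LinearMap.codRestrict P.domain LinearMap.id hP) M
    fun u => hb ⟨u, hP u⟩, ?_, LinearMap.mkContinuous_norm_le _ hM _⟩
  exact LinearPMap.ext (Submodule.eq_top_iff'.2 hP) fun _ _ _ => rfl

end UnboundedOperators

/-! ### The weighted estimate -/

theorem abs_exp_le_exp {a b : ℝ} (h : a ≤ b) : |Real.exp a| ≤ Real.exp b := by
  rw [Real.abs_exp]
  exact Real.exp_le_exp.2 h

/-- By the energy inequality and Cauchy–Schwarz, `‖∂ᵢψ‖² ≤ ‖Hψ‖ ‖ψ‖`, and both factors are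
controlled by `‖(H - z)ψ‖`. -/
theorem norm_derivTest_le {V : Space d → ℝ} (hV : LocallyEssBounded V) (h0 : ∀ᵐ x, 0 ≤ V x)
    {z : ℂ} {C Z : ℝ} (hC1 : 1 ≤ C) (hZ : ‖z‖ ≤ Z) {ψ : testFunctions d}
    (hC : ‖testToL2 d ψ‖ ≤ C * ‖schrodingerMap V hV ψ - z • testToL2 d ψ‖) (i : Fin d) :
    ‖testToL2 d (derivTest i ψ)‖ ≤
      (1 + C + Z * C ^ 2) * ‖schrodingerMap V hV ψ - z • testToL2 d ψ‖ := by
  set N := ‖schrodingerMap V hV ψ - z • testToL2 d ψ‖ with hN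
  have hN0 : 0 ≤ N := norm_nonneg _
  have hZ0 : 0 ≤ Z := (norm_nonneg _).trans hZ
  have h1 : ‖testToL2 d (derivTest i ψ)‖ ^ 2 ≤
      (inner ℂ (schrodingerMap V hV ψ) (testToL2 d ψ)).re :=
    (Finset.single_le_sum (f := fun i => ‖testToL2 d (derivTest i ψ)‖ ^ 2)
      (fun j _ => sq_nonneg _) (Finset.mem_univ i)).trans (energy_le hV h0 ψ)
  have h2 : (inner ℂ (schrodingerMap V hV ψ) (testToL2 d ψ)).re ≤
      ‖schrodingerMap V hV ψ‖ * ‖testToL2 d ψ‖ :=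
    (Complex.re_le_norm _).trans (norm_inner_le_norm _ _)
  have h3 : ‖schrodingerMap V hV ψ‖ ≤ N + Z * ‖testToL2 d ψ‖ := by
    have h := norm_add_le (schrodingerMap V hV ψ - z • testToL2 d ψ) (z • testToL2 d ψ)
    rw [sub_add_cancel, norm_smul] at h
    exact h.trans (add_le_add le_rfl (mul_le_mul_of_nonneg_right hZ (norm_nonneg _)))
  have h4 : ‖testToL2 d (derivTest i ψ)‖ ^ 2 ≤ (C + Z * C ^ 2) * N ^ 2 :=
    calc _ ≤ ‖schrodingerMap V hV ψ‖ * ‖testToL2 d ψ‖ := h1.trans h2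
      _ ≤ (N + Z * (C * N)) * (C * N) := by gcongr; exact h3.trans (by gcongr)
      _ = _ := by ring
  have h5 : 0 ≤ C + Z * C ^ 2 := by positivity
  -- A square root is avoided through `a ≤ (1 + a)²` with `a = C + Z C²`.
  refine le_of_sq_le_sq (h4.trans ?_) (by positivity)
  rw [mul_pow]
  gcongr
  nlinarith

/-- The core absorption estimate. Its constant `2 * C` does not depend on the upper bound `B` of the
exponent, which is what allows the regularization to be removed later. -/
theorem norm_exp_boundedMul_le {V : Space d → ℝ} (hV : LocallyEssBounded V)
    (h0 : ∀ᵐ x, 0 ≤ V x) {z : ℂ} {C Z : ℝ} (hC1 : 1 ≤ C) (hZ : ‖z‖ ≤ Z)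
    (hC : ∀ ψ : testFunctions d,
      ‖testToL2 d ψ‖ ≤ C * ‖schrodingerMap V hV ψ - z • testToL2 d ψ‖)
    {g : Space d → ℝ} (hg : ContDiff ℝ ∞ g) {B κ : ℝ} (hB : ∀ x, g x ≤ B) (hκ1 : κ ≤ 1)
    (hg1 : ∀ i x, |partialDeriv i g x| ≤ κ)
    (hg2 : ∀ i x, |partialDeriv i (partialDeriv i g) x| ≤ 2 * κ)
    (hκ : d * (κ * (2 * (1 + C + Z * C ^ 2) + 3 * C)) ≤ 1 / 2) (φ : testFunctions d) :
    ‖boundedMul (fun x => Real.exp (g x)) hg.exp.continuous (Real.exp B)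
        (fun x => abs_exp_le_exp (hB x)) (testToL2 d φ)‖ ≤
      2 * C * ‖boundedMul (fun x => Real.exp (g x)) hg.exp.continuous (Real.exp B)
        (fun x => abs_exp_le_exp (hB x)) (schrodingerMap V hV φ - z • testToL2 d φ)‖ := by
  set E := boundedMul (fun x => Real.exp (g x)) hg.exp.continuous (Real.exp B)
    (fun x => abs_exp_le_exp (hB x)) with hE
  set ψ := mulTest (fun x => Real.exp (g x)) hg.exp φ with hψ
  set N := ‖schrodingerMap V hV ψ - z • testToL2 d ψ‖ with hN
  have hcg1 (i : Fin d) : Continuous (partialDeriv i g) := (contDiff_partialDeriv i hg).continuous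
  have ha (i : Fin d) (x : Space d) : |2 * partialDeriv i g x| ≤ 2 * κ := by
    rw [abs_mul, abs_two]
    linarith [hg1 i x]
  have hac (i : Fin d) : Continuous fun x => 2 * partialDeriv i g x := (hcg1 i).const_mul 2
  have hb (i : Fin d) (x : Space d) :
      |partialDeriv i (partialDeriv i g) x - partialDeriv i g x ^ 2| ≤ 3 * κ := by
    -- Here `κ ≤ 1` gives `κ² ≤ κ`, hence `2κ + κ² ≤ 3κ`.
    refine (abs_sub _ _).trans ?_
    rw [abs_pow]
    nlinarith [hg1 i x, hg2 i x, abs_nonneg (partialDeriv i g x)]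
  have hbc (i : Fin d) : Continuous fun x =>
      partialDeriv i (partialDeriv i g) x - partialDeriv i g x ^ 2 :=
    (contDiff_partialDeriv i (contDiff_partialDeriv i hg)).continuous.sub ((hcg1 i).pow 2)
  have hEφ : E (testToL2 d φ) = testToL2 d ψ := by
    refine Lp.ext ?_
    filter_upwards [boundedMul_coeFn hg.exp.continuous (fun x => abs_exp_le_exp (hB x))
      (testToL2 d φ), testToL2_coeFn φ, testToL2_coeFn ψ] with x h1 h2 h3
    rw [h1, h2, h3]
    rfl
  let r (i : Fin d) : L2 d := boundedMul _ (hac i) _ (ha i) (testToL2 d (derivTest i ψ)) +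
    boundedMul _ (hbc i) _ (hb i) (testToL2 d ψ)
  have hr (i : Fin d) : r i =ᵐ[volume] fun x =>
      2 * ((partialDeriv i g x : ℝ) : ℂ) * (derivTest i ψ : Space d → ℂ) x +
        ((partialDeriv i (partialDeriv i g) x - partialDeriv i g x ^ 2 : ℝ) : ℂ) *
          (ψ : Space d → ℂ) x := by
    filter_upwards [Lp.coeFn_add (boundedMul _ (hac i) _ (ha i) (testToL2 d (derivTest i ψ)))
      (boundedMul _ (hbc i) _ (hb i) (testToL2 d ψ)),
      boundedMul_coeFn (hac i) (ha i) (testToL2 d (derivTest i ψ)),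
      boundedMul_coeFn (hbc i) (hb i) (testToL2 d ψ), testToL2_coeFn ψ,
      testToL2_coeFn (derivTest i ψ)] with x h1 h2 h3 h4 h5
    rw [h1, Pi.add_apply, h2, h3, h4, h5]
    push_cast
    rfl
  have hS : schrodingerMap V hV ψ = E (schrodingerMap V hV φ) - ∑ i, r i := by
    refine Lp.ext ?_
    filter_upwards [schrodingerMap_coeFn hV ψ, schrodingerMap_coeFn hV φ,
      boundedMul_coeFn hg.exp.continuous (fun x => abs_exp_le_exp (hB x))
        (schrodingerMap V hV φ), Lp.coeFn_sub (E (schrodingerMap V hV φ)) (∑ i, r i),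
      Lp.coeFn_finsetSum Finset.univ r, eventually_all.2 hr] with x h1 h2 h3 h4 h5 h6
    rw [h1, h4, Pi.sub_apply, h5, hE, h3, h2, Finset.sum_apply, Finset.sum_congr rfl fun i _ => h6 i]
    exact schrodingerFun_exp_mul V hg φ x
  have hrN (i : Fin d) : ‖r i‖ ≤ κ * (2 * (1 + C + Z * C ^ 2) + 3 * C) * N := by
    have hκ0 : 0 ≤ κ := (abs_nonneg _).trans (hg1 i 0)
    calc ‖r i‖ ≤ 2 * κ * ‖testToL2 d (derivTest i ψ)‖ + 3 * κ * ‖testToL2 d ψ‖ :=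
          (norm_add_le _ _).trans
            (add_le_add (norm_boundedMul_le _ _ _) (norm_boundedMul_le _ _ _))
      _ ≤ 2 * κ * ((1 + C + Z * C ^ 2) * N) + 3 * κ * (C * N) := by
          gcongr
          · exact norm_derivTest_le hV h0 hC1 hZ (hC ψ) i
          · exact hC ψ
      _ = _ := by ring
  -- The smallness condition on `κ` is exactly what makes the sum of the `d` error terms absorbable.
  have hsum : ‖∑ i, r i‖ ≤ 1 / 2 * N := by
    refine (norm_sum_le_of_le _ fun i _ => hrN i).trans ?_
    rw [Finset.sum_const, Finset.card_univ, Fintype.card_fin, nsmul_eq_mul, ← mul_assoc]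
    exact mul_le_mul_of_nonneg_right hκ (norm_nonneg _)
  have hfin : N ≤ 2 * ‖E (schrodingerMap V hV φ - z • testToL2 d φ)‖ := by
    have h : schrodingerMap V hV ψ - z • testToL2 d ψ =
        E (schrodingerMap V hV φ - z • testToL2 d φ) - ∑ i, r i := by
      rw [map_sub, map_smul, hEφ, hS]
      abel
    have h' : N ≤ ‖E (schrodingerMap V hV φ - z • testToL2 d φ)‖ + ‖∑ i, r i‖ := by
      rw [hN, h]
      exact norm_sub_le _ _
    linarith
  rw [hEφ]
  calc ‖testToL2 d ψ‖ ≤ C * N := hC ψ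
    _ ≤ C * (2 * ‖E (schrodingerMap V hV φ - z • testToL2 d φ)‖) := by gcongr
    _ = _ := by ring

/-! ### Extension from test functions to the closure -/

theorem testToL2_mem_domain {V : Space d → ℝ} (hV : LocallyEssBounded V) (φ : testFunctions d) :
    ∃ h : testToL2 d φ ∈ (hamiltonian V hV).domain,
      hamiltonian V hV ⟨testToL2 d φ, h⟩ = schrodingerMap V hV φ := by
  have h := (minimalHamiltonian V hV).le_closure
  have hm : testToL2 d φ ∈ (minimalHamiltonian V hV).domain := LinearMap.mem_range_self _ _
  exact ⟨h.1 hm, (h.2 (x := ⟨_, hm⟩) rfl).symm.trans (minimalHamiltonian_apply hV φ hm)⟩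

/-- By closability, the graph of `H` is the closure of the graph over test functions, so closed
conditions on pairs `(u, Hu)` need only be tested there. -/
theorem graph_hamiltonian_subset {V : Space d → ℝ} (hV : LocallyEssBounded V)
    {S : Set (L2 d × L2 d)} (hS : IsClosed S)
    (h : ∀ φ : testFunctions d, (testToL2 d φ, schrodingerMap V hV φ) ∈ S)
    (u : (hamiltonian V hV).domain) : ((u : L2 d), hamiltonian V hV u) ∈ S := by
  have hs : ((minimalHamiltonian V hV).graph : Set (L2 d × L2 d)) ⊆ S := by
    rintro ⟨a, b⟩ hp
    obtain ⟨⟨_, φ, rfl⟩, h1, h2⟩ := (LinearPMap.mem_graph_iff _).1 hp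
    have h3 : schrodingerMap V hV φ = b := (minimalHamiltonian_apply hV φ _).symm.trans h2
    have h1' : testToL2 d φ = a := h1
    rw [← h1', ← h3]
    exact h φ
  have hu : ((u : L2 d), hamiltonian V hV u) ∈ (hamiltonian V hV).graph :=
    LinearPMap.mem_graph _ u
  have hG : (minimalHamiltonian V hV).graph.topologicalClosure = (hamiltonian V hV).graph :=
    (minimalHamiltonian_isClosable hV).graph_closure_eq_closure_graph
  rw [← hG, ← SetLike.mem_coe, Submodule.topologicalClosure_coe] at hu
  exact closure_minimal hs hS hu

/-- The inequality is a closed condition on the graph because `E` is bounded; this is why bounded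
exponents are needed. -/
theorem norm_map_le_of_testFunctions {V : Space d → ℝ} (hV : LocallyEssBounded V) {z : ℂ} {M : ℝ}
    (E : L2 d →L[ℂ] L2 d)
    (h : ∀ φ : testFunctions d,
      ‖E (testToL2 d φ)‖ ≤ M * ‖E (schrodingerMap V hV φ - z • testToL2 d φ)‖)
    (u : (hamiltonian V hV).domain) :
    ‖E u‖ ≤ M * ‖E (hamiltonian V hV u - z • (u : L2 d))‖ := by
  have hc : IsClosed {p : L2 d × L2 d | ‖E p.1‖ ≤ M * ‖E (p.2 - z • p.1)‖} :=
    isClosed_le (E.continuous.comp continuous_fst).norm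
      ((E.continuous.comp (continuous_snd.sub (continuous_fst.const_smul z))).norm.const_mul M)
  exact graph_hamiltonian_subset hV hc h u

/-! ### Removal of the regularization -/

theorem tendsto_regExponent (κ : ℝ) (x : Space d) :
    Tendsto (fun n : ℕ => regExponent d κ (1 / ((n : ℝ) + 1)) x) atTop (𝓝 (κ * bracket x)) := by
  have h : Tendsto (fun n : ℕ => κ * bracket x / (1 + 1 / ((n : ℝ) + 1) * bracket x)) atTop
      (𝓝 (κ * bracket x / (1 + 0 * bracket x))) :=
    tendsto_const_nhds.div
      (tendsto_const_nhds.add (tendsto_one_div_add_atTop_nhds_zero_nat.mul_const _)) (by simp)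
  simpa [regExponent] using h

/-- Fatou's lemma along `ε = 1/(n+1)`: the weights converge pointwise and the norms are uniformly
bounded, so the limit lies in `L²` with the same bound. -/
theorem memLp_exp_bracket_mul {κ M : ℝ} (u : L2 d)
    (h : ∀ n : ℕ, eLpNorm (fun x => (Real.exp (regExponent d κ (1 / ((n : ℝ) + 1)) x) : ℂ) * u x)
      2 volume ≤ ENNReal.ofReal M) :
    MemLp (fun x => (Real.exp (κ * bracket x) : ℂ) * u x) 2 volume ∧
      eLpNorm (fun x => (Real.exp (κ * bracket x) : ℂ) * u x) 2 volume ≤ ENNReal.ofReal M := by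
  have hm (g : Space d → ℝ) (hg : Continuous g) :
      AEStronglyMeasurable (fun x => (Real.exp (g x) : ℂ) * u x) volume :=
    (Complex.continuous_ofReal.comp hg.rexp).aestronglyMeasurable.mul (Lp.aestronglyMeasurable u)
  have hle : eLpNorm (fun x => (Real.exp (κ * bracket x) : ℂ) * u x) 2 volume ≤
      ENNReal.ofReal M := by
    refine (Lp.eLpNorm_lim_le_liminf_eLpNorm
      (fun n : ℕ => hm _ (contDiff_regExponent (κ := κ) (ε := 1 / ((n : ℝ) + 1))
        (by positivity)).continuous) _ (Eventually.of_forall fun x => ?_)).trans ?_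
    · exact ((Complex.continuous_ofReal.tendsto _).comp
        ((Real.continuous_exp.tendsto _).comp (tendsto_regExponent κ x))).mul_const _
    · exact (liminf_le_liminf (Eventually.of_forall h)).trans (by simp)
  exact ⟨⟨hm _ (contDiff_bracket.continuous.const_mul κ), hle.trans_lt ENNReal.ofReal_lt_top⟩, hle⟩

theorem memLp_exp_bracket_mul_of_graph {V : Space d → ℝ} (hV : LocallyEssBounded V)
    (h0 : ∀ᵐ x, 0 ≤ V x) {z : ℂ} {C Z : ℝ} (hC1 : 1 ≤ C) (hZ : ‖z‖ ≤ Z)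
    (hC : ∀ u : (hamiltonian V hV).domain,
      ‖(u : L2 d)‖ ≤ C * ‖hamiltonian V hV u - z • (u : L2 d)‖)
    {κ : ℝ} (hκ0 : 0 ≤ κ) (hκ1 : κ ≤ 1)
    (hκ : d * (κ * (2 * (1 + C + Z * C ^ 2) + 3 * C)) ≤ 1 / 2)
    (u : (hamiltonian V hV).domain) (f : L2 d)
    (hf : ∀ᵐ x, (hamiltonian V hV u - z • (u : L2 d) : L2 d) x =
      (Real.exp (-κ * bracket x) : ℂ) * f x) :
    MemLp (fun x => (Real.exp (κ * bracket x) : ℂ) * (u : L2 d) x) 2 volume ∧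
      eLpNorm (fun x => (Real.exp (κ * bracket x) : ℂ) * (u : L2 d) x) 2 volume ≤
        ENNReal.ofReal (2 * C * ‖f‖) := by
  refine memLp_exp_bracket_mul _ fun n => ?_
  have hε : (0 : ℝ) < 1 / ((n : ℝ) + 1) := by positivity
  have hε1 : 1 / ((n : ℝ) + 1) ≤ 1 := by
    rw [div_le_one (by positivity)]
    linarith [(Nat.cast_nonneg n : (0 : ℝ) ≤ n)]
  set ε := 1 / ((n : ℝ) + 1)
  have hg := contDiff_regExponent (d := d) (κ := κ) hε.le
  have hB := regExponent_le_div (d := d) hκ0 hε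
  have hbound := norm_map_le_of_testFunctions hV _
    (norm_exp_boundedMul_le hV h0 hC1 hZ (fun ψ => by
      obtain ⟨h, h'⟩ := testToL2_mem_domain hV ψ
      rw [← h']
      exact hC ⟨_, h⟩) hg hB hκ1 (abs_partialDeriv_regExponent_le hκ0 hε.le)
      (abs_partialDeriv_partialDeriv_regExponent_le hκ0 hε.le hε1) hκ) u
  have hcoe (v : L2 d) := boundedMul_coeFn hg.exp.continuous (fun x => abs_exp_le_exp (hB x)) v
  rw [← eLpNorm_congr_ae (hcoe u), ← Lp.enorm_def, ← ofReal_norm]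
  refine ENNReal.ofReal_le_ofReal (hbound.trans ?_)
  refine mul_le_mul_of_nonneg_left ?_ (by positivity)
  refine Lp.norm_le_norm_of_ae_le ?_
  filter_upwards [hcoe (hamiltonian V hV u - z • (u : L2 d)), hf] with x h1 h2
  rw [h1, h2, ← mul_assoc, ← Complex.ofReal_mul, ← Real.exp_add, norm_mul, Complex.norm_real,
    Real.norm_eq_abs, Real.abs_exp]
  refine mul_le_of_le_one_left (norm_nonneg _) (Real.exp_le_one_iff.2 ?_)
  -- The combined weight `exp (g - κ⟨x⟩)` is at most `1` since `g ≤ κ⟨x⟩`, which makes the bound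
  -- uniform in `n`.
  linarith [regExponent_le_bracket hκ0 hε.le x]

/-- The natural domain is all of `L²`: the decaying weight is bounded, and the weighted estimate
places the resolvent's output in the domain of the growing weight. -/
theorem exists_pcomp_resolvent_eq_ofBounded {V : Space d → ℝ} (hV : LocallyEssBounded V)
    (h0 : ∀ᵐ x, 0 ≤ V x) {z : ℂ} (hz : z ∈ resolventSet (hamiltonian V hV)) {C Z : ℝ}
    (hC1 : 1 ≤ C) (hZ : ‖z‖ ≤ Z)
    (hC : ∀ u : (hamiltonian V hV).domain,
      ‖(u : L2 d)‖ ≤ C * ‖hamiltonian V hV u - z • (u : L2 d)‖)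
    {κ : ℝ} (hκ0 : 0 ≤ κ) (hκ1 : κ ≤ 1)
    (hκ : d * (κ * (2 * (1 + C + Z * C ^ 2) + 3 * C)) ≤ 1 / 2) :
    ∃ T : L2 d →L[ℂ] L2 d,
      pcomp (expWeight d κ) (pcomp (ofBounded (resolvent (hamiltonian V hV) z))
        (expWeight d (-κ))) = ofBounded T ∧ ‖T‖ ≤ 2 * C := by
  obtain ⟨hR, -⟩ := resolvent_spec hz
  have hw : Continuous fun x : Space d => Real.exp (-κ * bracket x) :=
    (contDiff_bracket.continuous.const_mul _).rexp
  have hw1 (x : Space d) : |Real.exp (-κ * bracket x)| ≤ 1 := by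
    rw [Real.abs_exp, Real.exp_le_one_iff]
    nlinarith [one_le_bracket x]
  have hdom (f : L2 d) : f ∈ (expWeight d (-κ)).domain := mem_mulDomain_of_bounded hw hw1 f
  have hest (f : L2 d) :
      MemLp (fun x => (Real.exp (κ * bracket x) : ℂ) *
        resolvent (hamiltonian V hV) z (expWeight d (-κ) ⟨f, hdom f⟩) x) 2 volume ∧
      eLpNorm (fun x => (Real.exp (κ * bracket x) : ℂ) *
        resolvent (hamiltonian V hV) z (expWeight d (-κ) ⟨f, hdom f⟩) x) 2 volume ≤
          ENNReal.ofReal (2 * C * ‖f‖) := by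
    obtain ⟨h, h'⟩ := hR (expWeight d (-κ) ⟨f, hdom f⟩)
    exact memLp_exp_bracket_mul_of_graph hV h0 hC1 hZ hC hκ0 hκ1 hκ ⟨_, h⟩ f
      (h'.symm ▸ mulOp_coeFn _ ⟨f, hdom f⟩)
  have hdom' (f : L2 d) : f ∈ (pcomp (ofBounded (resolvent (hamiltonian V hV) z))
      (expWeight d (-κ))).domain := mem_pcomp_domain (hdom f) Submodule.mem_top
  refine exists_eq_ofBounded (fun f => mem_pcomp_domain (B := expWeight d κ) (hdom' f) (hest f).1)
    (by positivity) ?_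
  rintro ⟨f, hf⟩
  change ‖MemLp.toLp _ (hest f).1‖ ≤ _
  rw [Lp.norm_toLp]
  exact ENNReal.toReal_le_of_le_ofReal (by positivity) (hest f).2

end

end ConfiningSchrodinger

theorem propositionA1 (d : ℕ) (V : ConfiningSchrodinger.Space d → ℝ)
    (hV : ConfiningSchrodinger.IsConfining V) (K : Set ℂ) (hK : IsCompact K)
    (hKρ : K ⊆ ConfiningSchrodinger.resolventSet
      (ConfiningSchrodinger.hamiltonian V hV.locallyEssBounded)) :
    ∃ ωK : ℝ, 0 < ωK ∧ ∃ MK : ℝ, ∀ z ∈ K, ∀ ω : ℝ, 0 ≤ ω → ω ≤ ωK →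
      ∃ T : ConfiningSchrodinger.L2 d →L[ℂ] ConfiningSchrodinger.L2 d,
        ConfiningSchrodinger.pcomp (ConfiningSchrodinger.expWeight d ω)
            (ConfiningSchrodinger.pcomp
              (ConfiningSchrodinger.ofBounded
                (ConfiningSchrodinger.resolvent
                  (ConfiningSchrodinger.hamiltonian V hV.locallyEssBounded) z))
              (ConfiningSchrodinger.expWeight d (-ω))) =
          ConfiningSchrodinger.ofBounded T ∧ ‖T‖ ≤ MK := by
  obtain ⟨C, hC1, hC⟩ :=
    ConfiningSchrodinger.exists_bound_of_isCompact_subset_resolventSet hK hKρ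
  obtain ⟨Z, hZ0, hZ⟩ := hK.isBounded.exists_pos_norm_le
  have hL : 0 < 2 * (1 + C + Z * C ^ 2) + 3 * C := by positivity
  have hL' : 0 < 2 * ((d : ℝ) + 1) * (2 * (1 + C + Z * C ^ 2) + 3 * C) := by positivity
  -- The second entry of the minimum enforces the smallness condition, with `d + 1` in place of `d`
  -- so that `d = 0` causes no division by zero. The first supplies `κ ≤ 1`.
  refine ⟨min 1 (1 / (2 * ((d : ℝ) + 1) * (2 * (1 + C + Z * C ^ 2) + 3 * C))),
    lt_min one_pos (by positivity), 2 * C, fun z hz ω hω0 hω => ?_⟩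
  refine ConfiningSchrodinger.exists_pcomp_resolvent_eq_ofBounded hV.locallyEssBounded hV.nonneg
    (hKρ hz) hC1 (hZ z hz) (hC z hz) hω0 (hω.trans (min_le_left _ _)) ?_
  have h := hω.trans (min_le_right _ _)
  rw [le_div_iff₀ hL'] at h
  have := mul_nonneg hω0 hL.le
  linarith
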